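/- Write $\mathcal{S}^n$ for the set of real symmetric $n\times n$ matrices. A matrix $A\in\mathcal{S}^n$ is *copositive* if $x^\top A x\ge 0$ for every entrywise nonnegative $x\in\mathbb{R}^n$, and it *admits an SPN decomposition* (is *SPN*) if it is the sum of a positive semidefinite matrix and an entrywise nonnegative matrix. For $A=(a_{i,j})\in\mathcal{S}^n$, let $A(i)$ denote the matrix obtained by deleting row $i$ and column $i$ and, if $a_{i,i}\ne 0$, let $A/a_{i,i}=A(i)-\frac{1}{a_{i,i}}vv^\top\in\mathcal{S}^{n-1}$ be the Schur complement, where $v\in\mathbb{R}^{n-1}$ is the $i$-th column of $A$ with its $i$-th entry removed. **Theorem 3.1.** Let $\mathcal{A}=\bigsqcup_{n\ge 1}\mathcal{A}_n$ be a disjoint union of sets of matrices $\mathcal{A}_n\subseteq\mathcal{S}^n$ such that, for each $n\ge 5$: 1. If $A\in\mathcal{A}_n$, then there is a row $i$ such that either all off-diagonal entries in row $i$ are nonnegative, or all off-diagonal entries in row $i$ are nonpositive and at least one of them is nonzero. 2. If $A\in\mathcal{A}_n$ and all off-diagonal entries in row $i$ are nonnegative, then $A(i)\in\mathcal{A}_{n-1}$.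 3. If $A\in\mathcal{A}_n$ has no row whose off-diagonal entries are all nonnegative, then there is a row $i$ with all off-diagonal entries nonpositive and $a_{i,i}\neq 0$ such that $A/a_{i,i}\in\mathcal{A}_{n-1}$. If $A\in\mathcal{A}$ is copositive, then $A$ admits an SPN decomposition. -/

import Mathlib

open scoped Matrix

namespace CopositiveSPN

/-- A real symmetric matrix `A` is copositive if `xᵀ A x ≥ 0` for every entrywise nonnegative
vector `x`. -/
def IsCopositive {n : ℕ} (A : Matrix (Fin n) (Fin n) ℝ) : Prop :=
  A.IsSymm ∧ ∀ x : Fin n → ℝ, (∀ i, 0 ≤ x i) → 0 ≤ x ⬝ᵥ (A *ᵥ x)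

/-- A real symmetric matrix `A` is SPN if it is the sum of a positive semidefinite matrix and an
entrywise nonnegative matrix. -/
def IsSPN {n : ℕ} (A : Matrix (Fin n) (Fin n) ℝ) : Prop :=
  A.IsSymm ∧ ∃ P N : Matrix (Fin n) (Fin n) ℝ,
    P.PosSemidef ∧ (∀ i j, 0 ≤ N i j) ∧ A = P + N

/-- All off-diagonal entries of row `i` are nonnegative. -/
def OffDiagNonneg {n : ℕ} (A : Matrix (Fin n) (Fin n) ℝ) (i : Fin n) : Prop :=
  ∀ j, j ≠ i → 0 ≤ A i j

/-- All off-diagonal entries of row `i` are nonpositive. -/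
def OffDiagNonpos {n : ℕ} (A : Matrix (Fin n) (Fin n) ℝ) (i : Fin n) : Prop :=
  ∀ j, j ≠ i → A i j ≤ 0

/-- The matrix `A(i)`, obtained from `A` by deleting row `i` and column `i`. -/
def deleteRowCol {n : ℕ} (A : Matrix (Fin (n + 1)) (Fin (n + 1)) ℝ) (i : Fin (n + 1)) :
    Matrix (Fin n) (Fin n) ℝ :=
  A.submatrix i.succAbove i.succAbove

/-- The Schur complement `A / a_{i,i}` of a diagonal entry: the matrix `A(i)` minus
`a_{i,i}⁻¹` times the outer product of column `i` and row `i` (with their `i`-th entries deleted).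
It is meaningful when `a_{i,i} ≠ 0`. -/
noncomputable def schurCompl {n : ℕ} (A : Matrix (Fin (n + 1)) (Fin (n + 1)) ℝ)
    (i : Fin (n + 1)) : Matrix (Fin n) (Fin n) ℝ :=
  Matrix.of fun j k =>
    A (i.succAbove j) (i.succAbove k) - (A i i)⁻¹ * (A (i.succAbove j) i * A i (i.succAbove k))

end CopositiveSPN

/-! Induction on the order. If row `i` has nonnegative off-diagonal part, a copositive `A` is `A(i)`
padded by zeros plus a nonnegative matrix (`isSPN_of_deleteRowCol`). If it is nonpositive and `A i i
> 0`, the Schur complement stays copositive (`IsCopositive.schurCompl`), and `A` is its padding plus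
a rank-one positive semidefinite matrix (`isSPN_of_schurCompl`).

The base case is that copositive matrices of order at most four are SPN. By Hahn–Banach
(`isSPN_of_isCopositive_of_doublyNonnegImpCP`) this is dual to doubly nonnegative matrices of order
four being completely positive (`doublyNonnegImpCP_four`), proved by splitting off rank-one terms
until the order drops. -/

open Matrix

/-! ### Rank-one subtraction and elimination for doubly nonnegative matrices. -/

namespace CopositiveSPN

/-- The cone of completely positive matrices: finite sums of `b bᵀ` with `b` entrywise
nonnegative. -/
def completelyPositive (n : ℕ) : AddSubmonoid (Matrix (Fin n) (Fin n) ℝ) :=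
  AddSubmonoid.closure {B | ∃ b : Fin n → ℝ, (∀ i, 0 ≤ b i) ∧ B = vecMulVec b b}

/-- A matrix is doubly nonnegative if it is positive semidefinite and entrywise nonnegative. -/
def IsDoublyNonneg {n : ℕ} (X : Matrix (Fin n) (Fin n) ℝ) : Prop :=
  X.PosSemidef ∧ ∀ i j, 0 ≤ X i j

section General

variable {m n : ℕ}

lemma posSemidef_isSymm {X : Matrix (Fin n) (Fin n) ℝ} (hX : X.PosSemidef) : X.IsSymm := by
  simpa [Matrix.IsHermitian, Matrix.IsSymm] using hX.isHermitian

lemma posSemidef_of_isSymm {X : Matrix (Fin n) (Fin n) ℝ} (hX : X.IsSymm)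
    (h : ∀ z, 0 ≤ z ⬝ᵥ (X *ᵥ z)) : X.PosSemidef :=
  .of_dotProduct_mulVec_nonneg (by simpa [Matrix.IsHermitian, Matrix.IsSymm] using hX)
    (by simpa using h)

lemma dotProduct_mulVec_nonneg_of_posSemidef {X : Matrix (Fin n) (Fin n) ℝ}
    (hX : X.PosSemidef) (z : Fin n → ℝ) : 0 ≤ z ⬝ᵥ (X *ᵥ z) := by
  simpa using hX.dotProduct_mulVec_nonneg z

lemma sq_apply_le_of_posSemidef {X : Matrix (Fin n) (Fin n) ℝ} (hX : X.PosSemidef)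
    (i j : Fin n) : X i j ^ 2 ≤ X i i * X j j := by
  have h := (hX.submatrix ![i, j]).det_nonneg
  have hs := (posSemidef_isSymm hX).apply i j
  rw [det_fin_two] at h
  simp only [submatrix_apply, cons_val_zero, cons_val_one] at h
  rw [hs] at h
  linarith [sq (X i j)]

lemma apply_eq_zero_of_diag_eq_zero {X : Matrix (Fin n) (Fin n) ℝ} (hX : X.PosSemidef)
    {i : Fin n} (hi : X i i = 0) (j : Fin n) : X i j = 0 := by
  have := sq_apply_le_of_posSemidef hX i j
  rw [hi, zero_mul] at this
  exact pow_eq_zero_iff two_ne_zero |>.1 (le_antisymm this (sq_nonneg _))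

/-- With `r = (X z) i`, the form of `X` at `z - t r eᵢ` is `zᵀXz - 2 t r² + t² r² X i i ≥ 0`; since
`t * X i i ≤ 1`, this yields `zᵀXz ≥ t r²`. -/
lemma posSemidef_sub_smul_vecMulVec_row {X : Matrix (Fin n) (Fin n) ℝ} (hX : X.PosSemidef)
    (i : Fin n) {t : ℝ} (ht0 : 0 ≤ t) (ht : t * X i i ≤ 1) :
    (X - t • vecMulVec (X i) (X i)).PosSemidef := by
  have hs := posSemidef_isSymm hX
  refine posSemidef_of_isSymm ?_ fun z => ?_
  · ext p q
    simp [vecMulVec_apply, hs.apply p q, mul_comm]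
  · set r := X i ⬝ᵥ z with hr
    have h := dotProduct_mulVec_nonneg_of_posSemidef hX (z - Pi.single i (t * r))
    have hcol : z ⬝ᵥ X.col i = r := by
      rw [hr, dotProduct_comm]
      congr 1
      ext j
      exact hs.apply i j
    have hrow : (X *ᵥ z) i = r := rfl
    simp only [mulVec_sub, dotProduct_sub, sub_dotProduct, single_dotProduct, mulVec_single,
      dotProduct_smul,
      hcol, hrow, col_apply, op_smul_eq_smul, smul_eq_mul] at h
    have hz : z ⬝ᵥ ((X - t • vecMulVec (X i) (X i)) *ᵥ z) = z ⬝ᵥ (X *ᵥ z) - t * r ^ 2 := by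
      simp only [sub_mulVec, smul_mulVec, vecMulVec_mulVec, dotProduct_sub, dotProduct_smul,
        op_smul_eq_smul, smul_eq_mul, ← hr]
      rw [dotProduct_comm z (X i), ← hr]
      ring
    rw [hz]
    nlinarith [mul_nonneg (mul_nonneg ht0 (sq_nonneg r)) (sub_nonneg.2 ht)]

/-- The `(n + 1) × n` matrix that inserts a zero coordinate at position `i`. -/
def insertZero (i : Fin (n + 1)) : Matrix (Fin (n + 1)) (Fin n) ℝ :=
  (1 : Matrix (Fin (n + 1)) (Fin (n + 1)) ℝ).submatrix id i.succAbove

lemma insertZero_nonneg (i : Fin (n + 1)) (p q) : 0 ≤ insertZero i p q := by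
  simp only [insertZero, submatrix_apply, one_apply, id]
  split_ifs <;> norm_num

lemma insertZero_mul_mul_transpose_deleteRowCol {X : Matrix (Fin (n + 1)) (Fin (n + 1)) ℝ}
    {i : Fin (n + 1)} (hrow : ∀ j, X i j = 0) (hcol : ∀ j, X j i = 0) :
    insertZero i * deleteRowCol X i * (insertZero i)ᵀ = X := by
  ext p q
  rcases Fin.eq_self_or_eq_succAbove i p with hp | ⟨p, rfl⟩ <;>
  rcases Fin.eq_self_or_eq_succAbove i q with hq | ⟨q, rfl⟩ <;>
  simp [*, insertZero, mul_apply, one_apply, deleteRowCol, Fin.succAbove_ne,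
    Fin.ne_succAbove]

lemma vecMulVec_mem_completelyPositive {b : Fin n → ℝ} (hb : ∀ i, 0 ≤ b i) :
    vecMulVec b b ∈ completelyPositive n :=
  AddSubmonoid.subset_closure ⟨b, hb, rfl⟩

lemma smul_vecMulVec_mem_completelyPositive {b : Fin n → ℝ} (hb : ∀ i, 0 ≤ b i) {t : ℝ}
    (ht : 0 ≤ t) : t • vecMulVec b b ∈ completelyPositive n := by
  have h := vecMulVec_mem_completelyPositive (b := √t • b)
    fun i => mul_nonneg (Real.sqrt_nonneg t) (hb i)
  rwa [vecMulVec_smul, smul_vecMulVec, smul_smul, Real.mul_self_sqrt ht] at h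

lemma mul_mul_transpose_mem_completelyPositive {C : Matrix (Fin m) (Fin n) ℝ}
    (hC : ∀ i j, 0 ≤ C i j) {X : Matrix (Fin n) (Fin n) ℝ} (hX : X ∈ completelyPositive n) :
    C * X * Cᵀ ∈ completelyPositive m := by
  induction hX using AddSubmonoid.closure_induction with
  | mem X h =>
    obtain ⟨b, hb, rfl⟩ := h
    rw [mul_vecMulVec, vecMulVec_mul, vecMul_transpose]
    exact vecMulVec_mem_completelyPositive fun i =>
      dotProduct_nonneg_of_nonneg (hC i) hb
  | zero => simp
  | add X Y _ _ hX hY => rw [Matrix.mul_add, Matrix.add_mul]; exact add_mem hX hY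

lemma mem_completelyPositive_of_row_eq_zero {X : Matrix (Fin (n + 1)) (Fin (n + 1)) ℝ}
    (hX : X.IsSymm) {i : Fin (n + 1)} (hrow : ∀ j, X i j = 0)
    (h : deleteRowCol X i ∈ completelyPositive n) : X ∈ completelyPositive (n + 1) := by
  rw [← insertZero_mul_mul_transpose_deleteRowCol hrow fun j => (hX.apply i j).trans (hrow j)]
  exact mul_mul_transpose_mem_completelyPositive (insertZero_nonneg i) h

lemma IsDoublyNonneg.submatrix {X : Matrix (Fin n) (Fin n) ℝ} (hX : IsDoublyNonneg X)
    (e : Fin m → Fin n) : IsDoublyNonneg (X.submatrix e e) :=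
  ⟨hX.1.submatrix e, fun i j => hX.2 (e i) (e j)⟩

/-- Every doubly nonnegative matrix of order `n` is completely positive. -/
def DoublyNonnegImpCP (n : ℕ) : Prop :=
  ∀ X : Matrix (Fin n) (Fin n) ℝ, IsDoublyNonneg X → X ∈ completelyPositive n

lemma DoublyNonnegImpCP.of_row_eq_zero (hn : DoublyNonnegImpCP n)
    {X : Matrix (Fin (n + 1)) (Fin (n + 1)) ℝ} (hX : IsDoublyNonneg X) {i : Fin (n + 1)}
    (hrow : ∀ j, X i j = 0) : X ∈ completelyPositive (n + 1) :=
  mem_completelyPositive_of_row_eq_zero (posSemidef_isSymm hX.1) hrow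
    (hn _ (hX.submatrix i.succAbove))

/-- If eliminating row `i` keeps all entries nonnegative, the order can be reduced. -/
lemma DoublyNonnegImpCP.of_elimination (hn : DoublyNonnegImpCP n)
    {X : Matrix (Fin (n + 1)) (Fin (n + 1)) ℝ} (hX : IsDoublyNonneg X) (i : Fin (n + 1))
    (h : ∀ p q, X i p * X i q ≤ X i i * X p q) : X ∈ completelyPositive (n + 1) := by
  rcases (hX.2 i i).eq_or_lt with hi | hi
  · exact hn.of_row_eq_zero hX (apply_eq_zero_of_diag_eq_zero hX.1 hi.symm)
  -- Row `i` of this residual vanishes, and `h` says precisely that its entries are nonnegative.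
  have hd : X - (X i i)⁻¹ • vecMulVec (X i) (X i) ∈ completelyPositive (n + 1) := by
    refine hn.of_row_eq_zero ⟨posSemidef_sub_smul_vecMulVec_row hX.1 i (inv_nonneg.2 hi.le)
      (inv_mul_cancel₀ hi.ne').le, fun p q => ?_⟩ (i := i) fun j => ?_
    · simp only [Matrix.sub_apply, Matrix.smul_apply, vecMulVec_apply, smul_eq_mul, sub_nonneg]
      rw [inv_mul_le_iff₀ hi]
      exact h p q
    · simp [vecMulVec_apply, hi.ne']
  have := add_mem hd
    (smul_vecMulVec_mem_completelyPositive (hX.2 i) (inv_nonneg.2 hi.le))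
  rwa [sub_add_cancel] at this

/-- The elimination inequality is automatic here, so only pairs of distinct indices other than `i`
ever need checking. -/
lemma mul_le_diag_of_mem_row {X : Matrix (Fin n) (Fin n) ℝ} (hX : X.PosSemidef) (i p q : Fin n)
    (h : p = i ∨ q = i ∨ p = q) : X i p * X i q ≤ X i i * X p q := by
  have hs := (posSemidef_isSymm hX).apply
  rcases h with rfl | rfl | rfl
  · rfl
  · rw [hs q p, mul_comm]
  · rw [← sq]; exact sq_apply_le_of_posSemidef hX i p

/-- Subtracting a multiple of `row i · (row i)ᵀ` produces an off-diagonal zero entry. -/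
lemma exists_isDoublyNonneg_with_zero {X : Matrix (Fin n) (Fin n) ℝ} (hX : IsDoublyNonneg X)
    (hn : 2 ≤ n) : ∃ Y, IsDoublyNonneg Y ∧ (∃ j k, j ≠ k ∧ Y j k = 0) ∧
      (Y ∈ completelyPositive n → X ∈ completelyPositive n) := by
  have hother : ∀ j : Fin n, ∃ k, j ≠ k := fun j => by
    by_contra! h
    have h1 := h ⟨0, by omega⟩
    have h2 := h ⟨1, by omega⟩
    simp [Fin.ext_iff] at h1 h2
    omega
  -- A diagonal zero is good enough: semidefiniteness then kills its whole row.
  suffices ∃ Y, IsDoublyNonneg Y ∧ (∃ j k, Y j k = 0) ∧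
      (Y ∈ completelyPositive n → X ∈ completelyPositive n) by
    obtain ⟨Y, hY, ⟨j, k, hjk⟩, h⟩ := this
    refine ⟨Y, hY, ?_, h⟩
    by_cases hne : j = k
    · subst hne
      obtain ⟨k, hk⟩ := hother j
      exact ⟨j, k, hk, apply_eq_zero_of_diag_eq_zero hY.1 hjk k⟩
    · exact ⟨j, k, hne, hjk⟩
  let i : Fin n := ⟨0, by omega⟩
  rcases (hX.2 i i).eq_or_lt with hi | hi
  · exact ⟨X, hX, ⟨i, i, hi.symm⟩, id⟩
  -- The minimal ratio over `S` is the largest `t` keeping all entries nonnegative. Since `(i, i)`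
  -- competes, `t * X i i ≤ 1`.
  let S : Finset (Fin n × Fin n) := Finset.univ.filter fun p => 0 < X i p.1 * X i p.2
  have hiS : (i, i) ∈ S := by simp [S, mul_pos hi hi]
  obtain ⟨⟨j, k⟩, hjk, hmin⟩ :=
    S.exists_min_image (fun p => X p.1 p.2 / (X i p.1 * X i p.2)) ⟨_, hiS⟩
  have hpos : 0 < X i j * X i k := by simpa [S] using hjk
  set t := X j k / (X i j * X i k) with ht
  have ht0 : 0 ≤ t := div_nonneg (hX.2 j k) hpos.le
  have hti : t * X i i ≤ 1 := by
    have h := hmin _ hiS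
    have h2 : X i i / (X i i * X i i) = (X i i)⁻¹ := by field_simp
    rw [h2] at h
    calc t * X i i ≤ (X i i)⁻¹ * X i i := by gcongr
      _ = 1 := inv_mul_cancel₀ hi.ne'
  refine ⟨X - t • vecMulVec (X i) (X i),
    ⟨posSemidef_sub_smul_vecMulVec_row hX.1 i ht0 hti, fun p q => ?_⟩, ⟨j, k, ?_⟩, fun h => ?_⟩
  · simp only [Matrix.sub_apply, Matrix.smul_apply, vecMulVec_apply, smul_eq_mul, sub_nonneg]
    rcases (mul_nonneg (hX.2 i p) (hX.2 i q)).eq_or_lt with h | h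
    · rw [← h, mul_zero]; exact hX.2 p q
    · exact (le_div_iff₀ h).1 (hmin (p, q) (by simpa [S] using h))
  · simp only [Matrix.sub_apply, Matrix.smul_apply, vecMulVec_apply, smul_eq_mul, ht]
    rw [div_mul_cancel₀ _ hpos.ne', sub_self]
  · have := add_mem h (smul_vecMulVec_mem_completelyPositive (hX.2 i) ht0)
    rwa [sub_add_cancel] at this

end General

/-! ### Doubly nonnegative implies completely positive, up to order four. -/

lemma doublyNonnegImpCP_zero : DoublyNonnegImpCP 0 := fun X _ => by
  rw [Subsingleton.elim X 0]; exact zero_mem _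

lemma doublyNonnegImpCP_one : DoublyNonnegImpCP 1 := fun _ hX =>
  doublyNonnegImpCP_zero.of_elimination hX 0 fun p q =>
    mul_le_diag_of_mem_row hX.1 0 p q (.inl (Subsingleton.elim _ _))

lemma doublyNonnegImpCP_two : DoublyNonnegImpCP 2 := fun X hX =>
  doublyNonnegImpCP_one.of_elimination hX 0 fun p q =>
    mul_le_diag_of_mem_row hX.1 0 p q (by omega)

/-- Once `Y j k = 0`, row `j` can be eliminated: any pair of distinct indices other than `j`
contains `k`, so the product to be bounded is zero. -/
lemma doublyNonnegImpCP_three : DoublyNonnegImpCP 3 := fun X hX => by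
  obtain ⟨Y, hY, ⟨j, k, hjk, h0⟩, h⟩ := exists_isDoublyNonneg_with_zero hX (by norm_num)
  refine h (doublyNonnegImpCP_two.of_elimination hY j fun p q => ?_)
  by_cases hpq : p = j ∨ q = j ∨ p = q
  · exact mul_le_diag_of_mem_row hY.1 j p q hpq
  have hk : p = k ∨ q = k := by omega
  have : Y j p * Y j q = 0 := by
    rcases hk with rfl | rfl <;> simp [h0]
  rw [this]
  exact mul_nonneg (hY.2 _ _) (hY.2 _ _)

/-- A doubly nonnegative matrix of order four with an off-diagonal zero entry is completely
positive. -/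
lemma mem_completelyPositive_of_apply_zero_one {X : Matrix (Fin 4) (Fin 4) ℝ}
    (hX : IsDoublyNonneg X) (h01 : X 0 1 = 0) : X ∈ completelyPositive 4 := by
  have hs := (posSemidef_isSymm hX.1).apply
  have elim : ∀ i k : Fin 4, i ≠ k → X i k = 0 →
      (∀ p q, p ≠ i → q ≠ i → p ≠ k → q ≠ k → p ≠ q → X i p * X i q ≤ X i i * X p q) →
      X ∈ completelyPositive 4 := by
    intro i k hik h0 h
    refine doublyNonnegImpCP_three.of_elimination hX i fun p q => ?_
    by_cases hpq : p = i ∨ q = i ∨ p = q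
    · exact mul_le_diag_of_mem_row hX.1 i p q hpq
    by_cases hk : p = k ∨ q = k
    · have : X i p * X i q = 0 := by rcases hk with rfl | rfl <;> simp [h0]
      rw [this]
      exact mul_nonneg (hX.2 _ _) (hX.2 _ _)
    · push Not at hpq hk
      exact h p q hpq.1 hpq.2.1 hk.1 hk.2 hpq.2.2
  -- Because of the zero, only the entry at `(2, 3)` can obstruct eliminating row 0 or row 1. If
  -- both are obstructed, `X 0 0` and `X 1 1` are positive.
  by_cases hA : X 0 2 * X 0 3 ≤ X 0 0 * X 2 3
  · refine elim 0 1 (by decide) h01 fun p q h1 h2 h3 h4 h5 => ?_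
    have : p = 2 ∧ q = 3 ∨ p = 3 ∧ q = 2 := by omega
    rcases this with ⟨rfl, rfl⟩ | ⟨rfl, rfl⟩
    · exact hA
    · rw [hs 2 3, mul_comm]; exact hA
  by_cases hB : X 1 2 * X 1 3 ≤ X 1 1 * X 2 3
  · refine elim 1 0 (by decide) ((hs 0 1).trans h01) fun p q h1 h2 h3 h4 h5 => ?_
    have : p = 2 ∧ q = 3 ∨ p = 3 ∧ q = 2 := by omega
    rcases this with ⟨rfl, rfl⟩ | ⟨rfl, rfl⟩
    · exact hB
    · rw [hs 2 3, mul_comm]; exact hB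
  have ha : 0 < X 0 0 := (hX.2 0 0).lt_of_ne fun h0 => hA <| by
    rw [apply_eq_zero_of_diag_eq_zero hX.1 h0.symm 2, ← h0]; simp
  have hd : 0 < X 1 1 := (hX.2 1 1).lt_of_ne fun h0 => hB <| by
    rw [apply_eq_zero_of_diag_eq_zero hX.1 h0.symm 2, ← h0]; simp
  have hq := dotProduct_mulVec_nonneg_of_posSemidef hX.1
  have n02 := hX.2 0 2
  have n03 := hX.2 0 3
  have n12 := hX.2 1 2
  have n13 := hX.2 1 3
  have n23 := hX.2 2 3
  have h10 : X 1 0 = 0 := (hs 0 1).trans h01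
  have hXe : X = !![X 0 0, 0, X 0 2, X 0 3; 0, X 1 1, X 1 2, X 1 3;
      X 0 2, X 1 2, X 2 2, X 2 3; X 0 3, X 1 3, X 2 3, X 3 3] := by
    ext i j
    fin_cases i <;> fin_cases j <;>
      simp [h01, h10, ← hs 0 2, ← hs 0 3, ← hs 1 2, ← hs 1 3, ← hs 2 3]
  generalize X 0 0 = a at *
  generalize X 0 2 = b at *
  generalize X 0 3 = c at *
  generalize X 1 1 = d at *
  generalize X 1 2 = e at *
  generalize X 1 3 = f at *
  generalize X 2 2 = g at *
  generalize X 2 3 = k at *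
  generalize X 3 3 = l at *
  subst hXe
  push Not at hA hB
  have hα : 0 < b * c / a := div_pos ((mul_nonneg ha.le n23).trans_lt hA) ha
  have hβ : 0 < e * f / d := div_pos ((mul_nonneg hd.le n23).trans_lt hB) hd
  set α := b * c / a with hαd
  set β := e * f / d with hβd
  have hαβ : α + β ≠ 0 := by positivity
  -- Minimising the form over the first two coordinates gives the Schur complement on `{2, 3}`.
  have hschur : ∀ u v : ℝ, 0 ≤ (g - b ^ 2 / a - e ^ 2 / d) * u ^ 2 + 2 * (k - α - β) * (u * v)
      + (l - c ^ 2 / a - f ^ 2 / d) * v ^ 2 := fun u v => by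
    have h := hq ![-(b * u + c * v) / a, -(e * u + f * v) / d, u, v]
    simp [mulVec, dotProduct, Fin.sum_univ_four] at h
    rw [hαd, hβd]
    convert h using 1
    field_simp
    ring
  let P := g - b ^ 2 / a - e ^ 2 / d
  let R := l - c ^ 2 / a - f ^ 2 / d
  -- The Schur complement is shared in the ratio `α : β`. This makes the off-diagonal entry of `Y`
  -- equal `α + α / (α + β) * (k - α - β) = α / (α + β) * k ≥ 0`, and likewise for `Z`, even when `k
  -- - α - β < 0`.
  let Y : Matrix (Fin 4) (Fin 4) ℝ := !![a, 0, b, c; 0, 0, 0, 0;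
    b, 0, b ^ 2 / a + α / (α + β) * P, α / (α + β) * k;
    c, 0, α / (α + β) * k, c ^ 2 / a + α / (α + β) * R]
  let Z : Matrix (Fin 4) (Fin 4) ℝ := !![0, 0, 0, 0; 0, d, e, f;
    0, e, e ^ 2 / d + β / (α + β) * P, β / (α + β) * k;
    0, f, β / (α + β) * k, f ^ 2 / d + β / (α + β) * R]
  have hYZ : !![a, 0, b, c; 0, d, e, f; b, e, g, k; c, f, k, l] = Y + Z := by
    have h1 : α / (α + β) = 1 - β / (α + β) := by field_simp; ring
    ext i j
    fin_cases i <;> fin_cases j <;> simp [Y, Z, P, R, h1] <;> ring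
  have hY : Y.PosSemidef := by
    refine posSemidef_of_isSymm (by ext i j; fin_cases i <;> fin_cases j <;> rfl) fun z => ?_
    have h : z ⬝ᵥ (Y *ᵥ z) = (a * z 0 + b * z 2 + c * z 3) ^ 2 / a + α / (α + β) *
        (P * z 2 ^ 2 + 2 * (k - α - β) * (z 2 * z 3) + R * z 3 ^ 2) := by
      have h1 : α / (α + β) * k = b * c / a + α / (α + β) * (k - α - β) := by
        rw [← hαd]; field_simp; ring
      simp [mulVec, dotProduct, Fin.sum_univ_four, Y, h1]
      generalize α / (α + β) = θ
      field_simp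
      ring
    rw [h]
    have := hschur (z 2) (z 3)
    positivity
  have hZ : Z.PosSemidef := by
    refine posSemidef_of_isSymm (by ext i j; fin_cases i <;> fin_cases j <;> rfl) fun z => ?_
    have h : z ⬝ᵥ (Z *ᵥ z) = (d * z 1 + e * z 2 + f * z 3) ^ 2 / d + β / (α + β) *
        (P * z 2 ^ 2 + 2 * (k - α - β) * (z 2 * z 3) + R * z 3 ^ 2) := by
      have h1 : β / (α + β) * k = e * f / d + β / (α + β) * (k - α - β) := by
        rw [← hβd]; field_simp; ring
      simp [mulVec, dotProduct, Fin.sum_univ_four, Z, h1]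
      generalize β / (α + β) = θ
      field_simp
      ring
    rw [h]
    have := hschur (z 2) (z 3)
    positivity
  have hY2 := hY.diag_nonneg (i := 2)
  have hY3 := hY.diag_nonneg (i := 3)
  have hZ2 := hZ.diag_nonneg (i := 2)
  have hZ3 := hZ.diag_nonneg (i := 3)
  have hYk : 0 ≤ α / (α + β) * k := by positivity
  have hZk : 0 ≤ β / (α + β) * k := by positivity
  rw [hYZ]
  refine add_mem
    (doublyNonnegImpCP_three.of_row_eq_zero ⟨hY, fun i j => ?_⟩ (i := 1) fun j => ?_)
    (doublyNonnegImpCP_three.of_row_eq_zero ⟨hZ, fun i j => ?_⟩ (i := 0) fun j => ?_)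
  · fin_cases i <;> fin_cases j <;> first | exact le_rfl | assumption | exact ha.le
  · fin_cases j <;> rfl
  · fin_cases i <;> fin_cases j <;> first | exact le_rfl | assumption | exact hd.le
  · fin_cases j <;> rfl

lemma submatrix_mem_completelyPositive {m n : ℕ} {X : Matrix (Fin n) (Fin n) ℝ}
    (hX : X ∈ completelyPositive n) (e : Fin m → Fin n) :
    X.submatrix e e ∈ completelyPositive m := by
  induction hX using AddSubmonoid.closure_induction with
  | mem X h =>
    obtain ⟨b, hb, rfl⟩ := h
    exact vecMulVec_mem_completelyPositive (b := b ∘ e) fun i => hb (e i)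
  | zero => simp
  | add X Y _ _ hX hY => rw [submatrix_add]; exact add_mem hX hY

/-- The Maxfield–Minc theorem: doubly nonnegative matrices of order four are completely
positive. -/
theorem doublyNonnegImpCP_four : DoublyNonnegImpCP 4 := fun X hX => by
  obtain ⟨Y, hY, ⟨j, k, hjk, h0⟩, h⟩ := exists_isDoublyNonneg_with_zero hX (by norm_num)
  refine h ?_
  obtain ⟨σ, rfl, rfl⟩ : ∃ σ : Equiv.Perm (Fin 4), σ 0 = j ∧ σ 1 = k := by
    clear h0
    revert j k
    decide
  have := submatrix_mem_completelyPositive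
    (mem_completelyPositive_of_apply_zero_one (hY.submatrix σ) h0) σ.symm
  simpa using this

end CopositiveSPN

/-! ### Duality between completely positive and copositive matrices. -/

namespace CopositiveSPN

open Filter Topology

variable {n : ℕ}

lemma isClosed_setOf_posSemidef : IsClosed {P : Matrix (Fin n) (Fin n) ℝ | P.PosSemidef} := by
  have h : {P : Matrix (Fin n) (Fin n) ℝ | P.PosSemidef} =
      {P | Pᵀ = P} ∩ ⋂ z : Fin n → ℝ, {P | 0 ≤ z ⬝ᵥ (P *ᵥ z)} := by
    ext P
    simp only [Set.mem_ofPred_eq, Set.mem_inter_iff, Set.mem_iInter]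
    exact ⟨fun h => ⟨posSemidef_isSymm h, dotProduct_mulVec_nonneg_of_posSemidef h⟩,
      fun h => posSemidef_of_isSymm h.1 h.2⟩
  rw [h]
  refine (isClosed_eq (by fun_prop) continuous_id).inter (isClosed_iInter fun z => ?_)
  exact isClosed_le continuous_const
    (continuous_const.dotProduct (continuous_id.matrix_mulVec continuous_const))

/-- The cone of (not necessarily symmetric) matrices that dominate a positive semidefinite matrix
entrywise. -/
def dominatingCone (n : ℕ) : Set (Fin n → Fin n → ℝ) :=
  {A | ∃ P : Matrix (Fin n) (Fin n) ℝ, P.PosSemidef ∧ ∀ i j, P i j ≤ A i j}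

lemma isSPN_of_mem_dominatingCone {A : Matrix (Fin n) (Fin n) ℝ} (hA : A.IsSymm)
    (h : (fun i j => A i j) ∈ dominatingCone n) : IsSPN A := by
  obtain ⟨P, hP, hPA⟩ := h
  exact ⟨hA, P, A - P, hP, fun i j => sub_nonneg.2 (hPA i j), (add_sub_cancel P A).symm⟩

lemma convex_dominatingCone : Convex ℝ (dominatingCone n) := by
  rintro A ⟨P, hP, hPA⟩ B ⟨Q, hQ, hQB⟩ a b ha hb -
  exact ⟨a • P + b • Q, (hP.smul ha).add (hQ.smul hb), fun i j =>
    add_le_add (mul_le_mul_of_nonneg_left (hPA i j) ha) (mul_le_mul_of_nonneg_left (hQB i j) hb)⟩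

/-- Along a convergent sequence the diagonals of the dominated matrices are bounded, hence by 2 × 2
minors so are all their entries; compactness supplies a limit. -/
lemma isClosed_dominatingCone : IsClosed (dominatingCone n) := by
  refine IsSeqClosed.isClosed fun u A hu hA => ?_
  choose P hP hPu using hu
  obtain ⟨C, hC⟩ := (Metric.isBounded_range_of_tendsto u hA).exists_norm_le
  have hentry : ∀ k i, u k i i ≤ C := fun k i =>
    (le_abs_self _).trans <| (norm_le_pi_norm (u k i) i).trans <|
      (norm_le_pi_norm (u k) i).trans (hC _ ⟨k, rfl⟩)
  have hC0 : 0 ≤ C := (norm_nonneg _).trans (hC _ ⟨0, rfl⟩)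
  have hbound : ∀ k, (fun i j => P k i j) ∈ Metric.closedBall (0 : Fin n → Fin n → ℝ) C := by
    intro k
    rw [mem_closedBall_zero_iff]
    refine (pi_norm_le_iff_of_nonneg hC0).2 fun i => (pi_norm_le_iff_of_nonneg hC0).2 fun j => ?_
    refine abs_le_of_sq_le_sq ?_ hC0
    calc P k i j ^ 2 ≤ P k i i * P k j j := sq_apply_le_of_posSemidef (hP k) i j
      _ ≤ C * C := mul_le_mul ((hPu k i i).trans (hentry k i)) ((hPu k j j).trans (hentry k j))
          (hP k).diag_nonneg hC0
      _ = C ^ 2 := (sq C).symm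
  obtain ⟨Q, -, φ, hφ, hQ⟩ := (isCompact_closedBall _ _).tendsto_subseq hbound
  have hQP : Tendsto (fun k => P (φ k)) atTop (𝓝 (Matrix.of Q)) := hQ
  refine ⟨Matrix.of Q, isClosed_setOf_posSemidef.mem_of_tendsto hQP (Eventually.of_forall fun k => hP _), fun i j => ?_⟩
  have h1 := tendsto_pi_nhds.1 (tendsto_pi_nhds.1 hQ i) j
  have h2 := tendsto_pi_nhds.1 (tendsto_pi_nhds.1 (hA.comp hφ.tendsto_atTop) i) j
  exact le_of_tendsto_of_tendsto' h1 h2 fun k => hPu (φ k) i j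

lemma pairing_nonneg_of_mem_completelyPositive {A X : Matrix (Fin n) (Fin n) ℝ}
    (hA : IsCopositive A) (hX : X ∈ completelyPositive n) : 0 ≤ ∑ i, ∑ j, A i j * X i j := by
  induction hX using AddSubmonoid.closure_induction with
  | mem X h =>
    obtain ⟨b, hb, rfl⟩ := h
    convert hA.2 b hb using 1
    simp only [dotProduct, mulVec, Finset.mul_sum, vecMulVec_apply]
    exact Finset.sum_congr rfl fun i _ => Finset.sum_congr rfl fun j _ => by ring
  | zero => simp
  | add X Y _ _ hX hY =>
    simp only [Matrix.add_apply, mul_add, Finset.sum_add_distrib]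
    exact add_nonneg hX hY

/-- If doubly nonnegative matrices of order `n` are completely positive, then dually copositive
matrices of order `n` are SPN. -/
theorem isSPN_of_isCopositive_of_doublyNonnegImpCP (hn : DoublyNonnegImpCP n)
    {A : Matrix (Fin n) (Fin n) ℝ} (hA : IsCopositive A) : IsSPN A := by
  refine isSPN_of_mem_dominatingCone hA.1 ?_
  by_contra hmem
  obtain ⟨f, u, hfA, hf⟩ :=
    geometric_hahn_banach_point_closed convex_dominatingCone isClosed_dominatingCone hmem
  have hu : u < 0 := by
    simpa using hf 0 ⟨0, PosSemidef.zero, fun i j => le_rfl⟩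
  -- A negative value could be rescaled inside the cone to equal `u`, against strict separation.
  have hfnonneg : ∀ B ∈ dominatingCone n, 0 ≤ f B := by
    rintro B ⟨P, hP, hPB⟩
    by_contra! hB
    have h := hf ((u / f B) • B) ⟨(u / f B) • P, hP.smul (div_nonneg_of_nonpos hu.le hB.le),
      fun i j => mul_le_mul_of_nonneg_left (hPB i j) (div_nonneg_of_nonpos hu.le hB.le)⟩
    rw [map_smul, smul_eq_mul, div_mul_cancel₀ _ hB.ne] at h
    exact h.false
  let E : Fin n → Fin n → Fin n → Fin n → ℝ := fun i j => Pi.single i (Pi.single j 1)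
  have hexp : ∀ B : Fin n → Fin n → ℝ, f B = ∑ i, ∑ j, B i j * f (E i j) := fun B => by
    have hB : B = ∑ i, ∑ j, B i j • E i j := by
      ext p q
      simp [E, Finset.sum_apply, Pi.single_apply, ite_apply]
    conv_lhs => rw [hB]
    simp [map_sum, map_smul]
  have hE : ∀ i j, 0 ≤ f (E i j) := fun i j => by
    refine hfnonneg _ ⟨0, PosSemidef.zero, fun p q => ?_⟩
    simp only [E, Matrix.zero_apply, Pi.single_apply]
    split_ifs <;> simp [Pi.single_apply]
    split_ifs <;> norm_num
  -- Symmetrised matrix of `f`, representing `2 f` on symmetric matrices. Its entries and its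
  -- quadratic form are nonnegative because each `E i j` and each `z zᵀ` lies in the cone.
  let X : Matrix (Fin n) (Fin n) ℝ := Matrix.of fun i j => f (E i j) + f (E j i)
  have hXpair : ∀ B : Matrix (Fin n) (Fin n) ℝ, B.IsSymm →
      ∑ i, ∑ j, B i j * X i j = 2 * f (fun i j => B i j) := fun B hB => by
    have h : ∑ i, ∑ j, B i j * f (E j i) = ∑ i, ∑ j, B i j * f (E i j) := by
      rw [Finset.sum_comm]
      exact Finset.sum_congr rfl fun i _ => Finset.sum_congr rfl fun j _ => by rw [hB.apply i j]
    simp only [X, Matrix.of_apply, mul_add, Finset.sum_add_distrib, h, hexp (fun i j => B i j)]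
    ring
  have hX : IsDoublyNonneg X := by
    refine ⟨posSemidef_of_isSymm (by ext i j; simp [X, add_comm]) fun z => ?_,
      fun i j => add_nonneg (hE i j) (hE j i)⟩
    have hsymm : (vecMulVec z z).IsSymm := by ext i j; simp [vecMulVec_apply, mul_comm]
    have hpsd : (vecMulVec z z).PosSemidef := by simpa using posSemidef_vecMulVec_self_star z
    have h : z ⬝ᵥ (X *ᵥ z) = ∑ i, ∑ j, vecMulVec z z i j * X i j := by
      simp only [dotProduct, mulVec, Finset.mul_sum, vecMulVec_apply]
      exact Finset.sum_congr rfl fun i _ => Finset.sum_congr rfl fun j _ => by ring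
    rw [h, hXpair _ hsymm]
    exact mul_nonneg zero_le_two (hfnonneg _ ⟨_, hpsd, fun i j => le_rfl⟩)
  have := pairing_nonneg_of_mem_completelyPositive hA (hn X hX)
  rw [hXpair A hA.1] at this
  linarith

end CopositiveSPN

/-! ### Nonnegative congruences and reduction of the order. -/

namespace CopositiveSPN

section Reduction

variable {m n : ℕ}

lemma mul_mul_transpose_quadratic (C : Matrix (Fin m) (Fin n) ℝ) (A : Matrix (Fin n) (Fin n) ℝ)
    (x : Fin m → ℝ) : x ⬝ᵥ ((C * A * Cᵀ) *ᵥ x) = (Cᵀ *ᵥ x) ⬝ᵥ (A *ᵥ (Cᵀ *ᵥ x)) := by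
  rw [← mulVec_mulVec, ← mulVec_mulVec, dotProduct_mulVec, ← mulVec_transpose]

lemma IsCopositive.mul_mul_transpose {A : Matrix (Fin n) (Fin n) ℝ} (hA : IsCopositive A)
    {C : Matrix (Fin m) (Fin n) ℝ} (hC : ∀ i j, 0 ≤ C i j) : IsCopositive (C * A * Cᵀ) := by
  refine ⟨by simp [IsSymm, Matrix.mul_assoc, hA.1.eq], fun x hx => ?_⟩
  rw [mul_mul_transpose_quadratic]
  exact hA.2 _ fun i => dotProduct_nonneg_of_nonneg (fun j => hC j i) hx

lemma IsSPN.mul_mul_transpose {A : Matrix (Fin n) (Fin n) ℝ} (hA : IsSPN A)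
    {C : Matrix (Fin m) (Fin n) ℝ} (hC : ∀ i j, 0 ≤ C i j) : IsSPN (C * A * Cᵀ) := by
  obtain ⟨hs, P, N, hP, hN, rfl⟩ := hA
  refine ⟨by simp [IsSymm, Matrix.mul_assoc, hs.eq], C * P * Cᵀ,
    C * N * Cᵀ, ?_, fun i j => ?_, by rw [Matrix.mul_add, Matrix.add_mul]⟩
  · simpa using hP.mul_mul_conjTranspose_same C
  · exact dotProduct_nonneg_of_nonneg
      (fun k => dotProduct_nonneg_of_nonneg (hC i) fun l => hN l k) (hC j)

lemma IsSPN.add_posSemidef {A P : Matrix (Fin n) (Fin n) ℝ} (hA : IsSPN A)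
    (hP : P.PosSemidef) : IsSPN (A + P) := by
  obtain ⟨hs, Q, N, hQ, hN, rfl⟩ := hA
  exact ⟨hs.add (posSemidef_isSymm hP), Q + P, N, hQ.add hP, hN, by abel⟩

lemma IsSPN.add_nonneg {A M : Matrix (Fin n) (Fin n) ℝ} (hA : IsSPN A)
    (hM : M.IsSymm) (hM0 : ∀ i j, 0 ≤ M i j) : IsSPN (A + M) := by
  obtain ⟨hs, Q, N, hQ, hN, rfl⟩ := hA
  exact ⟨hs.add hM, Q, N + M, hQ, fun i j => _root_.add_nonneg (hN i j) (hM0 i j), by abel⟩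

/-- Padding with zeros to order four and compressing back are both congruences by nonnegative
matrices. -/
lemma isSPN_of_isCopositive_of_le_four (hn : n ≤ 4) {A : Matrix (Fin n) (Fin n) ℝ}
    (hA : IsCopositive A) : IsSPN A := by
  let C : Matrix (Fin 4) (Fin n) ℝ := (1 : Matrix (Fin 4) (Fin 4) ℝ).submatrix id (Fin.castLE hn)
  have hC : ∀ i j, 0 ≤ C i j := fun i j => by
    simp only [C, submatrix_apply, one_apply]
    split_ifs <;> norm_num
  have hCC : Cᵀ * C = 1 := by
    ext i j
    simp [C, mul_apply, one_apply, Fin.castLE_inj]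
  have h := isSPN_of_isCopositive_of_doublyNonnegImpCP doublyNonnegImpCP_four
    (hA.mul_mul_transpose hC)
  have h2 := h.mul_mul_transpose (C := Cᵀ) fun i j => hC j i
  have h3 : Cᵀ * (C * A * Cᵀ) * Cᵀᵀ = A := by
    rw [transpose_transpose, ← Matrix.mul_assoc, ← Matrix.mul_assoc, hCC, Matrix.one_mul,
      Matrix.mul_assoc, hCC, Matrix.mul_one]
  rwa [h3] at h2

lemma IsCopositive.diag_nonneg {A : Matrix (Fin n) (Fin n) ℝ} (hA : IsCopositive A) (i : Fin n) :
    0 ≤ A i i := by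
  have h := hA.2 (Pi.single i 1) fun j => by
    rw [Pi.single_apply]; split_ifs <;> norm_num
  simpa using h

lemma IsCopositive.deleteRowCol {A : Matrix (Fin (n + 1)) (Fin (n + 1)) ℝ} (hA : IsCopositive A)
    (i : Fin (n + 1)) : IsCopositive (deleteRowCol A i) := by
  have h := hA.mul_mul_transpose (C := (insertZero i)ᵀ) fun p q => insertZero_nonneg i q p
  convert h
  ext p q
  simp [CopositiveSPN.deleteRowCol, insertZero, mul_apply, one_apply]

lemma isSPN_of_deleteRowCol {A : Matrix (Fin (n + 1)) (Fin (n + 1)) ℝ} (hA : IsCopositive A)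
    {i : Fin (n + 1)} (hi : OffDiagNonneg A i) (h : IsSPN (deleteRowCol A i)) : IsSPN A := by
  let M : Matrix (Fin (n + 1)) (Fin (n + 1)) ℝ :=
    Matrix.of fun p q => if p = i ∨ q = i then A p q else 0
  have hs := hA.1.apply
  have hM : M.IsSymm := by
    ext p q
    simp [M, or_comm, hs p q]
  have hrow : ∀ j, (A - M) i j = 0 := fun j => by simp [M]
  have hcol : ∀ j, (A - M) j i = 0 := fun j => by simp [M]
  have hdel : CopositiveSPN.deleteRowCol (A - M) i = CopositiveSPN.deleteRowCol A i := by
    ext p q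
    simp [CopositiveSPN.deleteRowCol, M, Fin.succAbove_ne]
  have h1 := h.mul_mul_transpose (insertZero_nonneg i)
  rw [← hdel, insertZero_mul_mul_transpose_deleteRowCol hrow hcol] at h1
  have h2 := h1.add_nonneg hM fun p q => ?_
  · rwa [sub_add_cancel] at h2
  have hnn : ∀ j, 0 ≤ A i j := fun j => by
    by_cases hj : j = i
    · rw [hj]; exact hA.diag_nonneg i
    · exact hi j hj
  simp only [M, Matrix.of_apply]
  split_ifs with hpq
  · rcases hpq with rfl | rfl
    · exact hnn q
    · rw [← hs]; exact hnn p
  · exact le_rfl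

lemma insertZero_mul_schurCompl_mul_transpose {A : Matrix (Fin (n + 1)) (Fin (n + 1)) ℝ}
    (hA : A.IsSymm) {i : Fin (n + 1)} (hi : A i i ≠ 0) :
    insertZero i * schurCompl A i * (insertZero i)ᵀ =
      A - (A i i)⁻¹ • vecMulVec (A i) (A i) := by
  have hdel : schurCompl A i = deleteRowCol (A - (A i i)⁻¹ • vecMulVec (A i) (A i)) i := by
    ext p q
    simp [schurCompl, deleteRowCol, vecMulVec_apply, hA.apply i]
  rw [hdel, insertZero_mul_mul_transpose_deleteRowCol]
  · intro j
    simp [vecMulVec_apply, hi]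
  · intro j
    simp [vecMulVec_apply, hi, hA.apply i, mul_comm (A i i)⁻¹]

lemma isSPN_of_schurCompl {A : Matrix (Fin (n + 1)) (Fin (n + 1)) ℝ} (hA : A.IsSymm)
    {i : Fin (n + 1)} (hi : 0 < A i i) (h : IsSPN (schurCompl A i)) : IsSPN A := by
  have h1 := h.mul_mul_transpose (insertZero_nonneg i)
  rw [insertZero_mul_schurCompl_mul_transpose hA hi.ne'] at h1
  have hpsd : ((A i i)⁻¹ • vecMulVec (A i) (A i)).PosSemidef :=
    PosSemidef.smul (by simpa using posSemidef_vecMulVec_self_star (A i)) (inv_nonneg.2 hi.le)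
  simpa using h1.add_posSemidef hpsd

/-- The Schur complement is `D * A * Dᵀ`, where `Dᵀ y` fills slot `i` with the minimiser of the form
given the other coordinates `y`. Nonpositivity of row `i` makes `D` nonnegative. -/
lemma IsCopositive.schurCompl {A : Matrix (Fin (n + 1)) (Fin (n + 1)) ℝ} (hA : IsCopositive A)
    {i : Fin (n + 1)} (hi : 0 < A i i) (hneg : OffDiagNonpos A i) :
    IsCopositive (schurCompl A i) := by
  let D : Matrix (Fin n) (Fin (n + 1)) ℝ :=
    Matrix.of fun p q => (insertZero i)ᵀ p q + if q = i then -(A i i)⁻¹ * A i (i.succAbove p) else 0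
  have hD : ∀ p q, 0 ≤ D p q := fun p q => by
    refine add_nonneg (insertZero_nonneg i q p) ?_
    split_ifs
    · have := mul_nonneg (inv_nonneg.2 hi.le) (neg_nonneg.2 (hneg _ (Fin.succAbove_ne i p)))
      linarith
    · exact le_rfl
  convert hA.mul_mul_transpose hD
  ext p q
  simp [D, CopositiveSPN.schurCompl, insertZero, mul_apply, one_apply, add_mul, mul_add,
    Finset.sum_add_distrib, hA.1.apply i]
  field_simp
  ring

end Reduction

end CopositiveSPN

/-! ### The induction on the order. -/

theorem theorem3p1
    (𝒜 : (n : ℕ) → Set (Matrix (Fin n) (Fin n) ℝ))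
    (hsymm : ∀ n, 1 ≤ n → ∀ A ∈ 𝒜 n, A.IsSymm)
    (hrow : ∀ n, 5 ≤ n → ∀ A ∈ 𝒜 n, ∃ i : Fin n,
      CopositiveSPN.OffDiagNonneg A i ∨
        (CopositiveSPN.OffDiagNonpos A i ∧ ∃ j, j ≠ i ∧ A i j ≠ 0))
    (hdelete : ∀ n, 5 ≤ n + 1 → ∀ A ∈ 𝒜 (n + 1), ∀ i : Fin (n + 1),
      CopositiveSPN.OffDiagNonneg A i → CopositiveSPN.deleteRowCol A i ∈ 𝒜 n)
    (hschur : ∀ n, 5 ≤ n + 1 → ∀ A ∈ 𝒜 (n + 1),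
      (¬ ∃ i : Fin (n + 1), CopositiveSPN.OffDiagNonneg A i) →
        ∃ i : Fin (n + 1), CopositiveSPN.OffDiagNonpos A i ∧ A i i ≠ 0 ∧
          CopositiveSPN.schurCompl A i ∈ 𝒜 n) :
    ∀ n, 1 ≤ n → ∀ A ∈ 𝒜 n, CopositiveSPN.IsCopositive A → CopositiveSPN.IsSPN A := by
  intro n
  induction n with
  | zero => intro h; omega
  | succ n ih =>
    intro _ A hA hcop
    -- The order is `n + 1`, so `n < 4` is exactly the base range.
    rcases Nat.lt_or_ge n 4 with hn | hn
    · exact CopositiveSPN.isSPN_of_isCopositive_of_le_four hn hcop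
    by_cases hnonneg : ∃ i, CopositiveSPN.OffDiagNonneg A i
    · obtain ⟨i, hi⟩ := hnonneg
      exact CopositiveSPN.isSPN_of_deleteRowCol hcop hi
        (ih (by omega) _ (hdelete n (by omega) A hA i hi) (hcop.deleteRowCol i))
    · obtain ⟨i, hi, hii, hmem⟩ := hschur n (by omega) A hA hnonneg
      have hpos : 0 < A i i := (hcop.diag_nonneg i).lt_of_ne' hii
      exact CopositiveSPN.isSPN_of_schurCompl hcop.1 hpos
        (ih (by omega) _ hmem (hcop.schurCompl hpos hi))
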